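/- Let $\Bbbk$ be a field of characteristic zero, let $n=2m$ be an even integer and let $S=\Bbbk[x_1,\dots,x_n]$ with the standard grading. For a homogeneous ideal $I\subset S$ and $A=S/I$, we say that the weak Lefschetz property (WLP) fails for $A$ in degree $i$ if for every linear form $\ell\in A_1$ the multiplication map $\times\ell: A_i\to A_{i+1}$ does not have maximal rank, that is, it is neither injective nor surjective. Consider the following ideals. 1. For $d\ge 5$ and $n\ge 4$, let $I=(x_1^d,\dots,x_n^d,\;x_1^3x_2^{d-3})$. 2. For $d=4$ and $n\ge 4$, let $I=(x_1^4,\dots,x_n^4,\;x_1x_2x_3x_4)$. 3. For $d=3$ and $n\ge 6$, let $I=(x_1^3,\dots,x_n^3,\;x_1x_2x_3)$. Then, in all cases, the WLP fails for $S/I$ in degree $m(d-1)-1$. -/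

import Mathlib

namespace Lefschetz

/-- The degree `i` piece `A_i` of `A = k[x_σ]/I` for the standard grading: the image in the
quotient of the space of homogeneous polynomials of degree `i`. -/
noncomputable def gradedPiece {σ k : Type*} [Field k] (I : Ideal (MvPolynomial σ k)) (i : ℕ) :
    Submodule k (MvPolynomial σ k ⧸ I) :=
  (MvPolynomial.homogeneousSubmodule σ k i).map (Ideal.Quotient.mkₐ k I).toLinearMap

theorem mul_mem_gradedPiece {σ k : Type*} [Field k] (I : Ideal (MvPolynomial σ k))
    {ℓ : MvPolynomial σ k ⧸ I} (hℓ : ℓ ∈ gradedPiece I 1) (i : ℕ)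
    (x : MvPolynomial σ k ⧸ I) (hx : x ∈ gradedPiece I i) :
    LinearMap.mulLeft k ℓ x ∈ gradedPiece I (i + 1) := by
  obtain ⟨p, hp, rfl⟩ := hℓ
  obtain ⟨q, hq, rfl⟩ := hx
  refine ⟨p * q, ?_, by simp⟩
  rw [add_comm]
  exact MvPolynomial.IsHomogeneous.mul hp hq

/-- The multiplication map `×ℓ : A_i → A_{i+1}` by a linear form `ℓ ∈ A_1`. -/
noncomputable def mulMap {σ k : Type*} [Field k] (I : Ideal (MvPolynomial σ k)) (ℓ : gradedPiece I 1) (i : ℕ) :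
    gradedPiece I i →ₗ[k] gradedPiece I (i + 1) :=
  (LinearMap.mulLeft k (ℓ : MvPolynomial σ k ⧸ I)).restrict (mul_mem_gradedPiece I ℓ.2 i)

/-- `×ℓ : A_i → A_{i+1}` has maximal rank: it is injective or surjective. -/
def HasMaximalRank {σ k : Type*} [Field k] (I : Ideal (MvPolynomial σ k)) (ℓ : gradedPiece I 1)
    (i : ℕ) : Prop :=
  Function.Injective (mulMap I ℓ i) ∨ Function.Surjective (mulMap I ℓ i)

/-- `A = k[x_σ]/I` fails the weak Lefschetz property in degree `i`: for no linear form `ℓ ∈ A_1`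
does the map `×ℓ : A_i → A_{i+1}` have maximal rank. In particular this covers the
sum of the variables. -/
def FailsWLPInDegree {σ k : Type*} [Field k] (I : Ideal (MvPolynomial σ k)) (i : ℕ) : Prop :=
  ∀ ℓ : gradedPiece I 1, ¬ HasMaximalRank I ℓ i

end Lefschetz

namespace Lefschetz

-- Put M = m(d-1). It suffices that dim A_M ≤ dim A_{M-1} and that no ℓ maps A_{M-1} onto A_M: an
-- injective ×ℓ would then also be surjective (`HasWitness.failsWLPInDegree`).
--
-- Non-surjectivity: if all coefficients of ℓ are nonzero, rescaling the variables turns ℓ into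
-- their sum. It is then enough to find an algebra with a common zero of the generators and of the
-- sum at which some monomial of degree M survives (`HasWitness`). Pairs (x, -x) with x^d = 0
-- contribute degree d-1 each. The extra generator vanishes on such a pair when d ≥ 5, and on
-- coinvariant algebras of S_4 and S_3 when d = 4 and d = 3. The remaining ℓ follow because
-- surjectivity is an open condition (`exists_surjective_ne_zero`).
--
-- Dimensions: counting standard monomials writes the Hilbert series as a difference of products of
-- polynomials 1 + X + ⋯ + X^(r-1). The inequality follows from symmetry and unimodality of the
-- powers of 1 + X + ⋯ + X^(d-1).

universe u

/-! ### Towers of algebras with a nonvanishing top monomial. -/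

/-- Adjoining a root `x` of a monic polynomial `f` to a `k`-algebra `R`. -/
theorem exists_adjoin_root (k : Type u) [Field k] (R : Type u) [CommRing R] [Algebra k R]
    (f : Polynomial R) (hf : f.Monic) :
    ∃ (T : Type u) (_ : CommRing T) (_ : Algebra k T) (φ : R →ₐ[k] T) (x : T),
      f.eval₂ (φ : R →+* T) x = 0 ∧
        ∀ (c : R) (e : ℕ), c ≠ 0 → e < f.natDegree → φ c * x ^ e ≠ 0 := by
  refine ⟨AdjoinRoot f, inferInstance, inferInstance, AdjoinRoot.ofAlgHom k f,
    AdjoinRoot.root f, ?_, ?_⟩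
  · simp
  · intro c e hc he h
    have hmk : AdjoinRoot.mk f (Polynomial.C c * Polynomial.X ^ e) = 0 := by
      simpa using h
    refine AdjoinRoot.mk_ne_zero_of_natDegree_lt hf ?_ ?_ hmk
    · intro h0
      apply hc
      simpa using congrArg (fun p => Polynomial.coeff p e) h0
    · exact (Polynomial.natDegree_C_mul_X_pow_le c e).trans_lt he

/-- Adjoining an element `x` with `x ^ d = 0`. -/
theorem exists_adjoin_nilpotent (k : Type u) [Field k] (R : Type u) [CommRing R] [Nontrivial R]
    [Algebra k R] (d : ℕ) :
    ∃ (T : Type u) (_ : CommRing T) (_ : Algebra k T) (φ : R →ₐ[k] T) (x : T),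
      x ^ d = 0 ∧ ∀ (c : R) (e : ℕ), c ≠ 0 → e < d → φ c * x ^ e ≠ 0 := by
  obtain ⟨T, _, _, φ, x, hx, hne⟩ :=
    exists_adjoin_root k R (Polynomial.X ^ d) (Polynomial.monic_X_pow d)
  refine ⟨T, inferInstance, inferInstance, φ, x, by simpa using hx, fun c e hc he => hne c e hc (by simpa using he)⟩

/-- The coinvariant algebra of the symmetric group on three letters, over a base ring `R`. -/
theorem exists_coinvariants_three (k : Type u) [Field k] (R : Type u) [CommRing R] [Nontrivial R]
    [Algebra k R] :
    ∃ (T : Type u) (_ : CommRing T) (_ : Algebra k T) (φ : R →ₐ[k] T) (x y : T),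
      x ^ 3 = 0 ∧ y ^ 2 + x * y + x ^ 2 = 0 ∧ ∀ c : R, c ≠ 0 → φ c * (x ^ 2 * y) ≠ 0 := by
  obtain ⟨T, _, _, φ, x, hx, hne⟩ := exists_adjoin_nilpotent k R 3
  have hT : Nontrivial T := ⟨⟨_, _, hne 1 0 one_ne_zero (by norm_num)⟩⟩
  have hdeg : (Polynomial.X ^ 2 + Polynomial.C x * Polynomial.X + Polynomial.C (x ^ 2) :
      Polynomial T).natDegree = 2 := by compute_degree!
  obtain ⟨U, _, _, ψ, y, hy, hne'⟩ := exists_adjoin_root k T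
    (Polynomial.X ^ 2 + Polynomial.C x * Polynomial.X + Polynomial.C (x ^ 2)) (by monicity!)
  refine ⟨U, inferInstance, inferInstance, ψ.comp φ, ψ x, y, by rw [← map_pow, hx, map_zero], by simpa [Polynomial.eval₂_pow] using hy, ?_⟩
  intro c hc
  have := hne' _ 1 (hne c 2 hc (by norm_num)) (by rw [hdeg]; norm_num)
  simpa [mul_assoc] using this

/-- The coinvariant algebra of the symmetric group on four letters. -/
theorem exists_coinvariants_four (k : Type u) [Field k] (R : Type u) [CommRing R] [Nontrivial R]
    [Algebra k R] :
    ∃ (T : Type u) (_ : CommRing T) (_ : Algebra k T) (x y z : T),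
      x ^ 4 = 0 ∧ y ^ 3 + x * y ^ 2 + x ^ 2 * y + x ^ 3 = 0 ∧
        z ^ 2 + (x + y) * z + (x ^ 2 + x * y + y ^ 2) = 0 ∧ x ^ 3 * y ^ 2 * z ≠ 0 := by
  obtain ⟨T, _, _, φ, x, hx, hne⟩ := exists_adjoin_nilpotent k R 4
  have hT : Nontrivial T := ⟨⟨_, _, hne 1 0 one_ne_zero (by norm_num)⟩⟩
  have hdeg : (Polynomial.X ^ 3 + Polynomial.C x * Polynomial.X ^ 2 +
      Polynomial.C (x ^ 2) * Polynomial.X + Polynomial.C (x ^ 3) :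
      Polynomial T).natDegree = 3 := by compute_degree!
  obtain ⟨U, _, _, ψ, y, hy, hne'⟩ := exists_adjoin_root k T
    (Polynomial.X ^ 3 + Polynomial.C x * Polynomial.X ^ 2 +
      Polynomial.C (x ^ 2) * Polynomial.X + Polynomial.C (x ^ 3)) (by monicity!)
  -- At each stage of the tower the largest exponent below the degree is taken: x^3, then y^2, then
  -- z.
  have hxy := hne' _ 2 (hne 1 3 one_ne_zero (by norm_num)) (by rw [hdeg]; norm_num)
  have hU : Nontrivial U := ⟨⟨_, _, hxy⟩⟩
  have hdeg' : (Polynomial.X ^ 2 + Polynomial.C (ψ x + y) * Polynomial.X +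
      Polynomial.C (ψ x ^ 2 + ψ x * y + y ^ 2) : Polynomial U).natDegree = 2 := by
    compute_degree!
  obtain ⟨V, _, _, χ, z, hz, hne''⟩ := exists_adjoin_root k U
    (Polynomial.X ^ 2 + Polynomial.C (ψ x + y) * Polynomial.X +
      Polynomial.C (ψ x ^ 2 + ψ x * y + y ^ 2)) (by monicity!)
  refine ⟨V, inferInstance, inferInstance, χ (ψ x), χ y, z, by simp only [← map_pow, hx, map_zero], ?_, ?_, ?_⟩
  · have := congrArg χ hy
    simpa [Polynomial.eval₂_pow] using this
  · simpa [Polynomial.eval₂_pow] using hz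
  · have := hne'' _ 1 hxy (by rw [hdeg']; norm_num)
    simpa [mul_assoc] using this

/-! ### Witnesses for a nonzero cokernel. -/

/-- There is a `k`-algebra with a zero `t` of `x₁ ^ d, …, xₙ ^ d`, of the monomial with exponents
`f` and of the sum of the variables at which some monomial of degree `M` does not vanish. -/
def HasWitness (k : Type u) [Field k] (d n M : ℕ) (f : ℕ → ℕ) : Prop :=
  ∃ (T : Type u) (_ : CommRing T) (_ : Algebra k T) (t : Fin n → T) (e : Fin n → ℕ),
    (∀ i, t i ^ d = 0) ∧ ∑ i, t i = 0 ∧ ∏ i, t i ^ f i = 0 ∧ ∑ i, e i = M ∧ ∏ i, t i ^ e i ≠ 0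

theorem HasWitness.add_pair {k : Type u} [Field k] {d n M : ℕ} {f : ℕ → ℕ} (hd : 1 ≤ d)
    (h : HasWitness k d n M f) : HasWitness k d (n + 2) (M + (d - 1)) f := by
  obtain ⟨R, _, _, t, e, h1, h2, h3, h4, h5⟩ := h
  have hR : Nontrivial R := ⟨⟨_, _, h5⟩⟩
  obtain ⟨T, _, _, φ, x, hx, hne⟩ := exists_adjoin_nilpotent k R d
  refine ⟨T, inferInstance, inferInstance, Fin.snoc (Fin.snoc (fun i => φ (t i)) x : Fin (n + 1) → T) (-x),
    Fin.snoc (Fin.snoc e (d - 1) : Fin (n + 1) → ℕ) 0, ?_, ?_, ?_, ?_, ?_⟩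
  · intro i
    refine Fin.lastCases ?_ (fun i => ?_) i
    · rw [Fin.snoc_last, neg_pow, hx, mul_zero]
    · refine Fin.lastCases ?_ (fun i => ?_) i
      · simpa using hx
      · simp [← map_pow, h1]
  · simp [Fin.sum_univ_castSucc, ← map_sum, h2]
  · simp [Fin.prod_univ_castSucc, ← map_pow, ← map_prod, h3]
  · simp [Fin.sum_univ_castSucc, h4]
  · simpa [Fin.prod_univ_castSucc, ← map_pow, ← map_prod] using hne _ (d - 1) h5 (by omega)

theorem HasWitness.add_pairs {k : Type u} [Field k] {d n M : ℕ} {f : ℕ → ℕ} (hd : 1 ≤ d)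
    (h : HasWitness k d n M f) (p : ℕ) :
    HasWitness k d (n + 2 * p) (M + p * (d - 1)) f := by
  induction p with
  | zero => simpa using h
  | succ p ih => convert ih.add_pair hd using 1 <;> ring

/-- At (x, -x) the extra monomial becomes ±x^(a+b) = ±x^d = 0. -/
theorem hasWitness_two (k : Type u) [Field k] {d a b : ℕ} (hd : 1 ≤ d) {f : ℕ → ℕ}
    (h0 : f 0 = a) (h1 : f 1 = b) (hab : a + b = d) : HasWitness k d 2 (d - 1) f := by
  obtain ⟨T, _, _, φ, x, hx, hne⟩ := exists_adjoin_nilpotent k k d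
  refine ⟨T, inferInstance, inferInstance, ![x, -x], ![d - 1, 0], ?_, by simp, ?_, by simp, ?_⟩
  · intro i
    fin_cases i
    · exact hx
    · change (-x) ^ d = 0
      rw [neg_pow, hx, mul_zero]
  · simp only [Fin.prod_univ_two, Matrix.cons_val_zero, Matrix.cons_val_one, Fin.val_zero,
      Fin.val_one, h0, h1, neg_pow x b]
    rw [mul_left_comm, ← pow_add, hab, hx, mul_zero]
  · simpa using hne 1 (d - 1) one_ne_zero (by omega)

theorem hasWitness_four (k : Type u) [Field k] {f : ℕ → ℕ} (hf : ∀ i < 4, f i = 1) :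
    HasWitness k 4 4 6 f := by
  obtain ⟨T, _, _, x, y, z, hx, hy, hz, hne⟩ := exists_coinvariants_four k k
  -- The relations say that the complete symmetric polynomials h_4(x), h_3(x,y), h_2(x,y,z) vanish.
  -- The others follow from divided differences such as h_3(x,z) - h_3(x,y) = (z-y) h_2(x,y,z).
  have hy4 : y ^ 4 = 0 := by linear_combination hx + (y - x) * hy
  have hxz : z ^ 3 + x * z ^ 2 + x ^ 2 * z + x ^ 3 = 0 := by linear_combination hy + (z - y) * hz
  refine ⟨T, inferInstance, inferInstance, ![x, y, z, -(x + y + z)], ![3, 2, 1, 0], ?_, ?_, ?_, ?_, ?_⟩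
  · intro i
    fin_cases i
    · exact hx
    · exact hy4
    · change z ^ 4 = 0
      linear_combination hx + (z - x) * hxz
    · change (-(x + y + z)) ^ 4 = 0
      -- The element -(x+y+z) is the second root of the quadratic satisfied by z, so `hz` applies to
      -- it unchanged.
      have hxw : (-(x + y + z)) ^ 3 + x * (-(x + y + z)) ^ 2 + x ^ 2 * (-(x + y + z)) + x ^ 3
          = 0 := by linear_combination hy + (-(x + y + z) - y) * hz
      linear_combination hx + (-(x + y + z) - x) * hxw
  · simp [Fin.sum_univ_four]
  · simp only [Fin.prod_univ_four, hf _ (Fin.isLt _), pow_one]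
    change x * y * z * -(x + y + z) = 0
    linear_combination -x * y * hz + x * hy - hx
  · simp [Fin.sum_univ_four]
  · simpa [Fin.prod_univ_four] using hne

/-- Three variables cannot be completed to an even number by pairs, so two copies of the S_3
coinvariants are stacked. Their top degrees add to 3 + 3 = 6, and the extra generator only involves
the first copy. -/
theorem hasWitness_six (k : Type u) [Field k] {f : ℕ → ℕ} (hf : ∀ i < 3, f i = 1)
    (hf' : ∀ i, 3 ≤ i → f i = 0) : HasWitness k 3 6 6 f := by
  obtain ⟨R, _, _, φ, x, y, hx, hy, hne⟩ := exists_coinvariants_three k k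
  have hR : Nontrivial R := ⟨⟨_, _, hne 1 one_ne_zero⟩⟩
  obtain ⟨T, _, _, ψ, z, w, hz, hw, hne'⟩ := exists_coinvariants_three k R
  have key : ∀ {A : Type u} [CommRing A] {x y : A}, x ^ 3 = 0 → y ^ 2 + x * y + x ^ 2 = 0 →
      y ^ 3 = 0 ∧ (-(x + y)) ^ 3 = 0 ∧ x * y * -(x + y) = 0 := by
    intro A _ x y hx hy
    refine ⟨?_, ?_, ?_⟩
    · linear_combination hx + (y - x) * hy
    · linear_combination hx + (-(x + y) - x) * hy
    · linear_combination hx - x * hy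
  obtain ⟨h1, h2, h3⟩ := key hx hy
  obtain ⟨h4, h5, -⟩ := key hz hw
  refine ⟨T, inferInstance, inferInstance, ![ψ x, ψ y, ψ (-(x + y)), z, w, -(z + w)], ![2, 1, 0, 2, 1, 0],
    ?_, ?_, ?_, ?_, ?_⟩
  · intro i
    fin_cases i
    · change ψ x ^ 3 = 0; rw [← map_pow, hx, map_zero]
    · change ψ y ^ 3 = 0; rw [← map_pow, h1, map_zero]
    · change ψ (-(x + y)) ^ 3 = 0; rw [← map_pow, h2, map_zero]
    · exact hz
    · exact h4
    · exact h5
  · simp [Fin.sum_univ_succ]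
  · have e : ∏ i : Fin 6, (![ψ x, ψ y, ψ (-(x + y)), z, w, -(z + w)] i) ^ f i =
        ψ (x * y * -(x + y)) := by
      simp [Fin.prod_univ_succ, hf, hf']
      ring
    rw [e, h3, map_zero]
  · simp [Fin.sum_univ_succ]
  · have := hne' _ (hne 1 one_ne_zero)
    simpa [Fin.prod_univ_succ, mul_assoc] using this

/-! ### Multiplication maps and Hilbert functions of monomial quotients. -/

section MonomialQuotient

open MvPolynomial

/-- The ideal generated by the `d`-th powers of the variables and the monomial with exponents
`f`. -/
noncomputable def almostCI (k : Type*) [Field k] (d n : ℕ) (f : ℕ → ℕ) :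
    Ideal (MvPolynomial (Fin n) k) :=
  Ideal.span (Set.range (fun i : Fin n => (X i : MvPolynomial (Fin n) k) ^ d) ∪
    {∏ i : Fin n, X i ^ f i})

/-- The class of the linear form `∑ aᵢ xᵢ`. -/
noncomputable def linForm {k : Type*} [Field k] {n : ℕ} (I : Ideal (MvPolynomial (Fin n) k))
    (a : Fin n → k) : gradedPiece I 1 :=
  ⟨Ideal.Quotient.mk I (∑ i, a i • X i), _,
    Submodule.sum_mem _ fun i _ => Submodule.smul_mem _ _ (isHomogeneous_X k i), rfl⟩

theorem exists_eq_linForm {k : Type*} [Field k] {n : ℕ} (I : Ideal (MvPolynomial (Fin n) k))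
    (ℓ : gradedPiece I 1) : ∃ a, ℓ = linForm I a := by
  obtain ⟨ℓ, p, hp, rfl⟩ := ℓ
  have hp' : p ∈ Submodule.span k (Set.range (X : Fin n → MvPolynomial (Fin n) k)) := by
    rw [← homogeneousSubmodule_one_eq_span_X]
    exact hp
  obtain ⟨a, rfl⟩ := (Submodule.mem_span_range_iff_exists_fun k).1 hp'
  exact ⟨a, rfl⟩

theorem mulMap_linForm_add_smul {k : Type*} [Field k] {n : ℕ}
    (I : Ideal (MvPolynomial (Fin n) k)) (a b : Fin n → k) (t : k) (i : ℕ) :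
    mulMap I (linForm I (a + t • b)) i =
      mulMap I (linForm I a) i + t • mulMap I (linForm I b) i := by
  have h : linForm I (a + t • b) = linForm I a + t • linForm I b := by
    apply Subtype.ext
    change Ideal.Quotient.mkₐ k I _ = Ideal.Quotient.mkₐ k I _ + t • Ideal.Quotient.mkₐ k I _
    rw [← map_smul, ← map_add]
    simp [add_smul, Finset.sum_add_distrib, mul_smul, Finset.smul_sum]
  ext x
  simp only [mulMap, h, LinearMap.coe_restrict_apply, LinearMap.mulLeft_apply,
    LinearMap.add_apply, LinearMap.smul_apply, Submodule.coe_add, Submodule.coe_smul, add_mul]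
  congr 1
  exact smul_mul_assoc _ _ _

/-- With H a right inverse of F, (F + tG)H = 1 + tGH is an endomorphism of W. It fails to be
injective only if -1/t is one of the finitely many eigenvalues of GH. -/
theorem finite_setOf_not_surjective_add_smul {k V W : Type*} [Field k] [AddCommGroup V]
    [Module k V] [AddCommGroup W] [Module k W] [FiniteDimensional k W] (F G : V →ₗ[k] W)
    (hF : Function.Surjective F) : {t : k | ¬ Function.Surjective (F + t • G)}.Finite := by
  obtain ⟨H, hH⟩ := F.exists_rightInverse_of_surjective (LinearMap.range_eq_top.2 hF)
  refine ((Module.End.finite_hasEigenvalue (G ∘ₗ H)).image fun μ => -μ⁻¹).subset ?_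
  intro t ht
  have hinj : ¬ Function.Injective ((F + t • G) ∘ₗ H) := by
    intro hinj
    apply ht
    have := LinearMap.surjective_of_injective hinj
    rw [LinearMap.coe_comp] at this
    exact this.of_comp
  rw [← LinearMap.ker_eq_bot, Submodule.eq_bot_iff] at hinj
  push Not at hinj
  obtain ⟨v, hv, hv0⟩ := hinj
  have h1 : v + t • G (H v) = 0 := by
    have h2 : F (H v) = v := LinearMap.congr_fun hH v
    simpa [h2] using hv
  have ht0 : t ≠ 0 := by
    rintro rfl
    exact hv0 (by simpa using h1)
  refine ⟨-t⁻¹, Module.End.hasEigenvalue_of_hasEigenvector (x := v) ⟨?_, hv0⟩, by simp⟩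
  rw [Module.End.mem_eigenspace_iff, LinearMap.comp_apply, neg_smul, eq_neg_iff_add_eq_zero,
    ← smul_right_injective W ht0 |>.eq_iff]
  simp [smul_smul, ht0, add_comm, h1]

/-- On the line a + t(1,…,1), finitely many t destroy surjectivity and finitely many make a
coordinate vanish. -/
theorem exists_surjective_ne_zero {k : Type*} [Field k] [Infinite k] {n : ℕ}
    (I : Ideal (MvPolynomial (Fin n) k)) (a : Fin n → k) (i : ℕ)
    [FiniteDimensional k (gradedPiece I (i + 1))]
    (h : Function.Surjective (mulMap I (linForm I a) i)) :
    ∃ b : Fin n → k, (∀ j, b j ≠ 0) ∧ Function.Surjective (mulMap I (linForm I b) i) := by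
  have h1 := finite_setOf_not_surjective_add_smul _ (mulMap I (linForm I 1) i) h
  obtain ⟨t, ht⟩ := (h1.union (Set.finite_range fun j => -a j)).exists_notMem
  simp only [Set.mem_union, Set.mem_ofPred_eq, Set.mem_range, not_or, not_not, not_exists] at ht
  refine ⟨a + t • 1, fun j hj => ht.2 j ?_, ?_⟩
  · rw [neg_eq_iff_add_eq_zero]
    simpa using hj
  · rw [mulMap_linForm_add_smul]
    exact ht.1

/-- Evaluation at x_j = t_j / a_j kills the ideal and ℓ, hence the image of ×ℓ, but not the witness
monomial. -/
theorem HasWitness.not_surjective {k : Type u} [Field k] {d n i : ℕ} {f : ℕ → ℕ}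
    (h : HasWitness k d n (i + 1) f) (a : Fin n → k) (ha : ∀ j, a j ≠ 0) :
    ¬ Function.Surjective (mulMap (almostCI k d n f) (linForm _ a) i) := by
  intro hs
  obtain ⟨T, _, _, t, e, h1, h2, h3, h4, h5⟩ := h
  let φ : MvPolynomial (Fin n) k →ₐ[k] T := aeval fun j => (a j)⁻¹ • t j
  have hφ : ∀ p ∈ almostCI k d n f, φ p = 0 := by
    have : almostCI k d n f ≤ RingHom.ker φ := by
      refine Ideal.span_le.2 ?_
      rintro p (⟨j, rfl⟩ | rfl)
      · simp [φ, RingHom.mem_ker, smul_pow, h1]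
      · simp [φ, RingHom.mem_ker, smul_pow, Finset.prod_smul, h3]
    exact this
  let ψ := Ideal.Quotient.liftₐ (almostCI k d n f) φ hφ
  have hg : (∏ j, X j ^ e j : MvPolynomial (Fin n) k).IsHomogeneous (i + 1) := by
    rw [← h4]
    refine IsHomogeneous.prod _ _ _ fun j _ => ?_
    simpa using (isHomogeneous_X k j).pow (e j)
  obtain ⟨x, hx⟩ := hs ⟨Ideal.Quotient.mk _ (∏ j, X j ^ e j), _, hg, rfl⟩
  have hx' := congrArg (fun y : gradedPiece (almostCI k d n f) (i + 1) => ψ y.1) hx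
  have hl : ψ (linForm (almostCI k d n f) a : MvPolynomial (Fin n) k ⧸ almostCI k d n f) = 0 := by
    change φ _ = 0
    simp [φ, smul_smul, ha, h2]
  have hr : ψ (Ideal.Quotient.mk _ (∏ j, X j ^ e j)) ≠ 0 := by
    change φ _ ≠ 0
    simp only [φ, map_prod, map_pow, aeval_X, smul_pow, Finset.prod_smul]
    refine (smul_ne_zero_iff_right ?_).2 h5
    exact Finset.prod_ne_zero_iff.2 fun j _ => pow_ne_zero _ (inv_ne_zero (ha j))
  apply hr
  rw [← hx']
  simp [mulMap, hl]

/-- The weak Lefschetz property fails if the Hilbert function does not increase and the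
cokernel is nonzero. -/
theorem HasWitness.failsWLPInDegree {k : Type u} [Field k] [Infinite k] {d n i : ℕ} {f : ℕ → ℕ}
    (h : HasWitness k d n (i + 1) f)
    [FiniteDimensional k (gradedPiece (almostCI k d n f) i)]
    [FiniteDimensional k (gradedPiece (almostCI k d n f) (i + 1))]
    (hdim : Module.finrank k (gradedPiece (almostCI k d n f) (i + 1)) ≤
      Module.finrank k (gradedPiece (almostCI k d n f) i)) :
    FailsWLPInDegree (almostCI k d n f) i := by
  have hns : ∀ ℓ, ¬ Function.Surjective (mulMap (almostCI k d n f) ℓ i) := by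
    intro ℓ hs
    obtain ⟨a, rfl⟩ := exists_eq_linForm _ ℓ
    obtain ⟨b, hb, hbs⟩ := exists_surjective_ne_zero _ a i hs
    exact h.not_surjective b hb hbs
  rintro ℓ (hi | hs)
  · have heq := le_antisymm (LinearMap.finrank_le_finrank_of_injective hi) hdim
    exact hns ℓ ((LinearMap.injective_iff_surjective_of_finrank_eq_finrank heq).1 hi)
  · exact hns ℓ hs

/-- The exponents of degree `i` that are not above any element of `G`. -/
def standardExponents {σ : Type*} (G : Set (σ →₀ ℕ)) (i : ℕ) : Set (σ →₀ ℕ) :=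
  {s | s.degree = i ∧ ∀ g ∈ G, ¬ g ≤ s}

/-- The standard monomials of degree `i` form a basis of the degree `i` piece of the quotient by
a monomial ideal. -/
theorem nonempty_linearEquiv_gradedPiece {σ k : Type*} [Field k] (G : Set (σ →₀ ℕ)) (i : ℕ) :
    Nonempty (restrictSupport k (standardExponents G i) ≃ₗ[k]
      gradedPiece (Ideal.span ((fun s => monomial s (1 : k)) '' G)) i) := by
  set I := Ideal.span ((fun s => monomial s (1 : k)) '' G) with hI
  set B := standardExponents G i
  let π := (Ideal.Quotient.mkₐ k I).toLinearMap
  have hmap : gradedPiece I i = LinearMap.range (π.domRestrict (restrictSupport k B)) := by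
    rw [LinearMap.range_domRestrict]
    apply le_antisymm
    · rw [gradedPiece, homogeneousSubmodule_eq_finsupp_supported]
      change (restrictSupport k _).map π ≤ _
      rw [restrictSupport_eq_span, Submodule.map_span_le]
      rintro _ ⟨s, hs, rfl⟩
      by_cases hsB : s ∈ B
      · exact Submodule.mem_map_of_mem ((monomial_mem_restrictSupport k).2 (Or.inl hsB))
      · have : ∃ g ∈ G, g ≤ s := by
          by_contra! hcon
          exact hsB ⟨hs, hcon⟩
        have hmem : (monomial s (1 : k)) ∈ I := by
          rw [hI, mem_ideal_span_monomial_image]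
          intro x hx
          obtain rfl : x = s := by simpa using support_monomial_subset hx
          exact this
        have h0 : π (monomial s 1) = 0 := Ideal.Quotient.eq_zero_iff_mem.2 hmem
        rw [h0]
        exact zero_mem _
    · refine Submodule.map_mono ?_
      intro p hp
      rw [mem_homogeneousSubmodule]
      intro s hs
      have := ((mem_restrictSupport_iff k).1 hp) (mem_support_iff.2 hs)
      rw [← this.1]
      exact Finsupp.degree_eq_weight_one (R := ℕ) ▸ rfl
  have hinj : Function.Injective (π.domRestrict (restrictSupport k B)) := by
    rw [← LinearMap.ker_eq_bot, Submodule.eq_bot_iff]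
    rintro ⟨p, hp⟩ h0
    have hpI : p ∈ I := Ideal.Quotient.eq_zero_iff_mem.1 h0
    rw [hI, mem_ideal_span_monomial_image] at hpI
    have hsupp : p.support = ∅ := by
      refine Finset.eq_empty_of_forall_notMem fun s hs => ?_
      obtain ⟨g, hg, hgs⟩ := hpI s hs
      exact (((mem_restrictSupport_iff k).1 hp) hs).2 g hg hgs
    exact Subtype.ext (support_eq_empty.1 hsupp)
  exact ⟨(LinearEquiv.ofInjective _ hinj).trans (LinearEquiv.ofEq _ _ hmap.symm)⟩

theorem finite_standardExponents {σ : Type*} [Finite σ] (G : Set (σ →₀ ℕ)) (i : ℕ) :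
    (standardExponents G i).Finite := by
  refine (Finsupp.finite_of_degree_le i).subset fun s hs => hs.1.le

theorem finiteDimensional_gradedPiece {σ k : Type*} [Finite σ] [Field k] (G : Set (σ →₀ ℕ))
    (i : ℕ) :
    FiniteDimensional k (gradedPiece (Ideal.span ((fun s => monomial s (1 : k)) '' G)) i) := by
  obtain ⟨e⟩ := nonempty_linearEquiv_gradedPiece (k := k) G i
  have := (finite_standardExponents G i).to_subtype
  have := Module.Finite.of_basis (basisRestrictSupport k (standardExponents G i))
  exact Module.Finite.equiv e

theorem finrank_gradedPiece {σ k : Type*} [Field k] (G : Set (σ →₀ ℕ)) (i : ℕ) :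
    Module.finrank k (gradedPiece (Ideal.span ((fun s => monomial s (1 : k)) '' G)) i) =
      (standardExponents G i).ncard := by
  obtain ⟨e⟩ := nonempty_linearEquiv_gradedPiece (k := k) G i
  rw [← e.finrank_eq,
    Module.finrank_eq_nat_card_basis (basisRestrictSupport k (standardExponents G i))]
  rfl

/-- The exponents of the generators of `almostCI`. -/
def almostCIExponents (d n : ℕ) (f : ℕ → ℕ) : Set (Fin n →₀ ℕ) :=
  Set.range (fun j => Finsupp.single j d) ∪ {Finsupp.equivFunOnFinite.symm fun j : Fin n => f j}

theorem almostCI_eq_span (k : Type*) [Field k] (d n : ℕ) (f : ℕ → ℕ) :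
    almostCI k d n f =
      Ideal.span ((fun s => monomial s (1 : k)) '' almostCIExponents d n f) := by
  rw [almostCI, almostCIExponents, Set.image_union, ← Set.range_comp, Set.image_singleton]
  congr 2
  · congr 1
    ext1 j
    simp [X_pow_eq_monomial]
  · rw [monomial_eq]
    simp [Finsupp.prod_fintype]

/-- The number of tuples `s` with `sⱼ ∈ t j` for all `j` and sum `i` is a coefficient of a
product of polynomials. -/
theorem card_filter_sum_eq_coeff {n : ℕ} (t : Fin n → Finset ℕ) (i : ℕ) :
    (((Fintype.piFinset t).filter fun s => ∑ j, s j = i).card : ℤ) =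
      (∏ j, ∑ a ∈ t j, (Polynomial.X : Polynomial ℤ) ^ a).coeff i := by
  rw [Finset.prod_univ_sum, Polynomial.finsetSum_coeff, Finset.card_filter]
  push_cast
  refine Finset.sum_congr rfl fun s _ => ?_
  rw [Finset.prod_pow_eq_pow_sum, Polynomial.coeff_X_pow]
  simp [eq_comm]

/-- Standard exponents fill the box of tuples with entries below d, minus the sub-box lying above f.
-/
theorem ncard_standardExponents_almostCI {d n : ℕ} {f : ℕ → ℕ} (i : ℕ) :
    ((standardExponents (almostCIExponents d n f) i).ncard : ℤ) =
      (∏ _j : Fin n, ∑ a ∈ Finset.range d, (Polynomial.X : Polynomial ℤ) ^ a).coeff i -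
      (∏ j : Fin n, ∑ a ∈ Finset.Ico (f j) d, (Polynomial.X : Polynomial ℤ) ^ a).coeff i := by
  have hsub : ((Fintype.piFinset fun j : Fin n => Finset.Ico (f j) d).filter
      fun s => ∑ j, s j = i) ⊆
      (Fintype.piFinset fun _ : Fin n => Finset.range d).filter fun s => ∑ j, s j = i :=
    Finset.filter_subset_filter _ (Fintype.piFinset_subset _ _ fun j a ha => by simp_all)
  rw [← card_filter_sum_eq_coeff, ← card_filter_sum_eq_coeff, ← Nat.cast_sub, Nat.cast_inj,
    ← Finset.card_sdiff_of_subset]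
  · rw [← Set.ncard_coe_finset, ← Set.ncard_image_of_injective _
      (Finsupp.equivFunOnFinite : (Fin n →₀ ℕ) ≃ (Fin n → ℕ)).injective]
    congr 1
    ext s
    rw [Equiv.image_eq_preimage_symm]
    have hdeg : (Finsupp.equivFunOnFinite.symm s : Fin n →₀ ℕ).degree = ∑ j, s j := by
      simp [Finsupp.degree_eq_sum]
    have hle : (Finsupp.equivFunOnFinite.symm fun j : Fin n => f j) ≤
        Finsupp.equivFunOnFinite.symm s ↔ ∀ j : Fin n, f j ≤ s j := by
      simp [Finsupp.le_def]
    simp only [standardExponents, almostCIExponents, Set.union_singleton, Set.mem_insert_iff,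
      Set.mem_range, forall_eq_or_imp, forall_exists_index, forall_apply_eq_imp_iff,
      Set.mem_preimage, Set.mem_ofPred_eq, hdeg, hle, Finsupp.single_le_iff,
      Finsupp.coe_equivFunOnFinite_symm, Finset.coe_sdiff, Finset.coe_filter, Set.mem_sdiff,
      Fintype.mem_piFinset, Finset.mem_range, Finset.mem_Ico, not_le]
    constructor
    · rintro ⟨h1, h2, h3⟩
      exact ⟨⟨h3, h1⟩, fun h => h2 fun j => (h.1 j).1⟩
    · rintro ⟨⟨h3, h1⟩, h2⟩
      exact ⟨h1, fun h => h2 ⟨fun j => ⟨h j, h3 j⟩, h1⟩, h3⟩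
  · exact hsub
  · exact Finset.card_le_card hsub

end MonomialQuotient

/-! ### Symmetric unimodal coefficient sequences and the dimension inequality. -/

section HilbertFunction

open Polynomial

/-- The coefficient of an integer polynomial at an integer exponent. -/
noncomputable def intCoeff (j : ℤ) : ℤ[X] →ₗ[ℤ] ℤ := if 0 ≤ j then lcoeff ℤ j.toNat else 0

theorem intCoeff_natCast (j : ℕ) (Q : ℤ[X]) : intCoeff j Q = Q.coeff j := by
  simp [intCoeff]

/-- Integer indices make the shift valid without assuming a ≤ j. -/
theorem intCoeff_X_pow_mul (a : ℕ) (j : ℤ) (Q : ℤ[X]) :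
    intCoeff j (X ^ a * Q) = intCoeff (j - a) Q := by
  rcases le_or_gt 0 j with hj | hj
  · lift j to ℕ using hj
    rw [intCoeff_natCast, coeff_X_pow_mul']
    split_ifs with h
    · rw [← Nat.cast_sub h, intCoeff_natCast]
    · rw [intCoeff, if_neg (by omega), LinearMap.zero_apply]
  · rw [intCoeff, intCoeff, if_neg (by omega), if_neg (by omega), LinearMap.zero_apply,
      LinearMap.zero_apply]

/-- The polynomial `1 + X + ⋯ + X ^ (d - 1)`. -/
noncomputable def geomPoly (d : ℕ) : ℤ[X] := ∑ a ∈ Finset.range d, X ^ a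

theorem sum_Ico_X_pow (a b : ℕ) :
    ∑ i ∈ Finset.Ico a b, (X : ℤ[X]) ^ i = X ^ a * geomPoly (b - a) := by
  rw [Finset.sum_Ico_eq_sum_range, geomPoly, Finset.mul_sum]
  simp only [pow_add]

theorem intCoeff_geomPoly_mul (d : ℕ) (j : ℤ) (Q : Polynomial ℤ) :
    intCoeff j (geomPoly d * Q) = ∑ a ∈ Finset.range d, intCoeff (j - a) Q := by
  rw [geomPoly, Finset.sum_mul, map_sum]
  simp only [intCoeff_X_pow_mul]

theorem intCoeff_geomPoly_mul_sub (d : ℕ) (j : ℤ) (Q : Polynomial ℤ) :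
    intCoeff j (geomPoly d * Q) - intCoeff (j - 1) (geomPoly d * Q) =
      intCoeff j Q - intCoeff (j - d) Q := by
  rw [intCoeff_geomPoly_mul, intCoeff_geomPoly_mul, ← Finset.sum_sub_distrib]
  have := Finset.sum_range_sub' (fun a : ℕ => intCoeff (j - a) Q) d
  rw [Nat.cast_zero, sub_zero] at this
  rw [← this]
  refine Finset.sum_congr rfl fun a _ => ?_
  rw [Nat.cast_succ, sub_sub, add_comm (1 : ℤ)]

/-- The sequence `q` is symmetric about `c / 2` and decreases away from `c / 2`. -/
def SymmUnimodal (c : ℤ) (q : ℤ → ℤ) : Prop :=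
  ∀ i j, min j (c - j) ≤ i → i ≤ max j (c - j) → q j ≤ q i

theorem SymmUnimodal.reflect {c : ℤ} {q : ℤ → ℤ} (h : SymmUnimodal c q) (i j : ℤ)
    (hij : i + j = c) : q i = q j :=
  le_antisymm (h _ _ (by omega) (by omega)) (h _ _ (by omega) (by omega))

theorem SymmUnimodal.of_le {c : ℤ} {q : ℤ → ℤ} (hr : ∀ i, q (c - i) = q i)
    (hs : ∀ i, 2 * i ≤ c + 1 → q (i - 1) ≤ q i) : SymmUnimodal c q := by
  have hmono : ∀ j i, j ≤ i → 2 * i ≤ c + 1 → q j ≤ q i := by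
    intro j i hji
    induction i, hji using Int.leInduction with
    | base => exact fun _ => le_rfl
    | succ i hji ih =>
      intro hi
      have := hs (i + 1) hi
      rw [add_sub_cancel_right] at this
      exact (ih (by omega)).trans this
  intro i j h1 h2
  rcases le_total (2 * i) c with hi | hi <;> rcases le_total (2 * j) c with hj | hj
  · exact hmono _ _ (by omega) (by omega)
  · rw [← hr j]; exact hmono _ _ (by omega) (by omega)
  · rw [← hr i]; exact hmono _ _ (by omega) (by omega)
  · rw [← hr i, ← hr j]; exact hmono _ _ (by omega) (by omega)

/-- The increment at i telescopes to q(i) - q(i-d). Up to the new centre, i is no farther from c/2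
than i-d. -/
theorem SymmUnimodal.geomPoly_mul {c : ℤ} {Q : Polynomial ℤ}
    (h : SymmUnimodal c fun j => intCoeff j Q) {d : ℕ} (hd : 1 ≤ d) :
    SymmUnimodal (c + (d - 1)) fun j => intCoeff j (geomPoly d * Q) := by
  refine SymmUnimodal.of_le (fun i => ?_) (fun i hi => ?_)
  · rw [intCoeff_geomPoly_mul, intCoeff_geomPoly_mul, ← Finset.sum_range_reflect]
    refine Finset.sum_congr rfl fun a ha => ?_
    have := Finset.mem_range.1 ha
    exact h.reflect _ _ (by omega)
  · have h1 := intCoeff_geomPoly_mul_sub d i Q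
    have h2 := h i (i - d) (by omega) (by omega)
    simp only at h2 ⊢
    linarith

theorem symmUnimodal_geomPoly_pow {d : ℕ} (hd : 1 ≤ d) (N : ℕ) :
    SymmUnimodal (N * (d - 1)) fun j => intCoeff j (geomPoly d ^ N) := by
  induction N with
  | zero =>
    intro i j h1 h2
    have h1j : ∀ j, intCoeff j (1 : Polynomial ℤ) = if j = 0 then 1 else 0 := by
      intro j
      rcases le_or_gt 0 j with hj | hj
      · lift j to ℕ using hj
        simp [intCoeff_natCast, Polynomial.coeff_one]
      · rw [intCoeff, if_neg (by omega), if_neg (by omega), LinearMap.zero_apply]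
    simp only [pow_zero, h1j, Nat.cast_zero, zero_mul] at *
    split_ifs <;> omega
  | succ N ih =>
    have := ih.geomPoly_mul hd
    rw [pow_succ']
    convert this using 1
    push_cast
    ring

/-- Let q be the coefficients of Q = `geomPoly d * T`, with centre C = M-d+1. Telescoping and
reflecting reduce the claim to q(C) + q(C-d+2) + q(C-d+1) ≤ q(C-1) + q(C-2) + q(C-3). Besides
unimodality this needs the concavity q(C) - q(C-1) ≤ q(C-2) - q(C-3), which comes from unimodality
of T; hence the factor split off from Q. -/
theorem intCoeff_sub_le_of_five_le {d : ℕ} (hd : 5 ≤ d) {c M : ℤ} {T : ℤ[X]}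
    (hT : SymmUnimodal c fun j => intCoeff j T) (hM : 2 * M = c + 3 * (d - 1)) :
    intCoeff M (geomPoly d * (geomPoly d * (geomPoly d * T)) -
        X ^ d * (geomPoly (d - 3) * (geomPoly 3 * (geomPoly d * T)))) ≤
      intCoeff (M - 1) (geomPoly d * (geomPoly d * (geomPoly d * T)) -
        X ^ d * (geomPoly (d - 3) * (geomPoly 3 * (geomPoly d * T)))) := by
  set Q := geomPoly d * T with hQdef
  have hQ := hT.geomPoly_mul (d := d) (by omega)
  have hgQ := hQ.geomPoly_mul (d := d) (by omega)
  rw [← hQdef] at hQ hgQ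
  have e1 := intCoeff_geomPoly_mul_sub d M (geomPoly d * Q)
  have e2 := intCoeff_geomPoly_mul_sub (d - 3) (M - d) (geomPoly 3 * Q)
  have e3 := intCoeff_geomPoly_mul_sub d (M + 1) Q
  have e4 := hgQ.reflect (M - d) (M + 1) (by omega)
  have g3 : ∀ j, intCoeff j (geomPoly 3 * Q) =
      intCoeff j Q + intCoeff (j - 1) Q + intCoeff (j - 2) Q := fun j => by
    rw [intCoeff_geomPoly_mul]
    simp [Finset.sum_range_succ]
  have e5 := hQ.reflect (M + 1) (M - 2 * d + 1) (by omega)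
  -- This comparison, q(C-d+2) ≤ q(C-3), is where d ≥ 5 is needed.
  have e6 := hQ (M - d - 2) (M - 2 * d + 3) (by omega) (by omega)
  have e7 := hQ (M - d - 2) (M - 2 * d + 2) (by omega) (by omega)
  have e8 := intCoeff_geomPoly_mul_sub d (M - d + 1) T
  have e9 := intCoeff_geomPoly_mul_sub d (M - d - 1) T
  have e10 := hT (M - d - 1) (M - d + 1) (by omega) (by omega)
  have e11 := hT (M - d + 1 - d) (M - d - 1 - d) (by omega) (by omega)
  rw [← hQdef] at e8 e9
  rw [g3, g3] at e2
  push_cast [show 3 ≤ d by omega] at e2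
  simp only [map_sub, intCoeff_X_pow_mul] at *
  ring_nf at *
  linarith

/-- If u_k is the coefficient of Q at distance k from its centre M-6, the increment is u_6 + 3u_5 +
2u_4 + 2u_3 - 2u_2 - 4u_1 - 2u_0. Its partial sums 1, 4, 6, 8, 6, 2, 0 are nonnegative and u_k
decreases in k, so it is at most 0. -/
theorem intCoeff_sub_le_four {c M : ℤ} {Q : Polynomial ℤ}
    (hQ : SymmUnimodal c fun j => intCoeff j Q) (hM : 2 * M = c + 12) :
    intCoeff M (geomPoly 4 ^ 4 * Q - Polynomial.X ^ 4 * (geomPoly 3 ^ 4 * Q)) ≤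
      intCoeff (M - 1) (geomPoly 4 ^ 4 * Q - Polynomial.X ^ 4 * (geomPoly 3 ^ 4 * Q)) := by
  have hP : geomPoly 4 ^ 4 * Q - Polynomial.X ^ 4 * (geomPoly 3 ^ 4 * Q) =
      Polynomial.X ^ 0 * Q + (4 : ℤ) • (Polynomial.X ^ 1 * Q) + (10 : ℤ) • (Polynomial.X ^ 2 * Q)
      + (20 : ℤ) • (Polynomial.X ^ 3 * Q) + (30 : ℤ) • (Polynomial.X ^ 4 * Q)
      + (36 : ℤ) • (Polynomial.X ^ 5 * Q) + (34 : ℤ) • (Polynomial.X ^ 6 * Q)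
      + (24 : ℤ) • (Polynomial.X ^ 7 * Q) + (12 : ℤ) • (Polynomial.X ^ 8 * Q)
      + (4 : ℤ) • (Polynomial.X ^ 9 * Q) := by
    simp only [geomPoly, Finset.sum_range_succ, Finset.sum_range_zero, zsmul_eq_mul]
    push_cast
    ring
  have r1 := hQ.reflect (M - 7) (M - 5) (by omega)
  have r2 := hQ.reflect (M - 8) (M - 4) (by omega)
  have r3 := hQ.reflect (M - 9) (M - 3) (by omega)
  have r4 := hQ.reflect (M - 10) (M - 2) (by omega)
  have s0 := hQ (M - 6) (M - 5) (by omega) (by omega)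
  have s1 := hQ (M - 5) (M - 4) (by omega) (by omega)
  have s2 := hQ (M - 4) (M - 3) (by omega) (by omega)
  have s3 := hQ (M - 3) (M - 2) (by omega) (by omega)
  have s4 := hQ (M - 2) (M - 1) (by omega) (by omega)
  have s5 := hQ (M - 1) M (by omega) (by omega)
  rw [hP]
  simp only [map_add, map_smul, intCoeff_X_pow_mul, smul_eq_mul, sub_sub] at *
  norm_num at *
  linarith

/-- After reflection about M-3 the increment collapses to the difference of the coefficients of Q at
M and M-1. -/
theorem intCoeff_sub_le_three {c M : ℤ} {Q : Polynomial ℤ}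
    (hQ : SymmUnimodal c fun j => intCoeff j Q) (hM : 2 * M = c + 6) :
    intCoeff M (geomPoly 3 ^ 3 * Q - Polynomial.X ^ 3 * (geomPoly 2 ^ 3 * Q)) ≤
      intCoeff (M - 1) (geomPoly 3 ^ 3 * Q - Polynomial.X ^ 3 * (geomPoly 2 ^ 3 * Q)) := by
  have hP : geomPoly 3 ^ 3 * Q - Polynomial.X ^ 3 * (geomPoly 2 ^ 3 * Q) =
      Polynomial.X ^ 0 * Q + (3 : ℤ) • (Polynomial.X ^ 1 * Q) + (6 : ℤ) • (Polynomial.X ^ 2 * Q)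
      + (6 : ℤ) • (Polynomial.X ^ 3 * Q) + (3 : ℤ) • (Polynomial.X ^ 4 * Q) := by
    simp only [geomPoly, Finset.sum_range_succ, Finset.sum_range_zero, zsmul_eq_mul]
    push_cast
    ring
  have r1 := hQ.reflect (M - 4) (M - 2) (by omega)
  have r2 := hQ.reflect (M - 5) (M - 1) (by omega)
  have s0 := hQ (M - 3) (M - 2) (by omega) (by omega)
  have s1 := hQ (M - 2) (M - 1) (by omega) (by omega)
  have s2 := hQ (M - 1) M (by omega) (by omega)
  rw [hP]
  simp only [map_add, map_smul, intCoeff_X_pow_mul, smul_eq_mul, sub_sub] at *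
  norm_num at *
  linarith

end HilbertFunction

/-! ### Assembly of the three families. -/

theorem failsWLPInDegree_almostCI {k : Type u} [Field k] [CharZero k] {d n M : ℕ} {f : ℕ → ℕ}
    (hM : 1 ≤ M) (h : HasWitness k d n M f) {P : Polynomial ℤ}
    (hP : ∏ _j : Fin n, geomPoly d -
      ∏ j : Fin n, (Polynomial.X : Polynomial ℤ) ^ f j * geomPoly (d - f j) = P)
    (hle : intCoeff M P ≤ intCoeff (M - 1) P) :
    FailsWLPInDegree (almostCI k d n f) (M - 1) := by
  obtain ⟨i, rfl⟩ := Nat.exists_eq_add_of_le' hM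
  have hfin : ∀ i, FiniteDimensional k (gradedPiece (almostCI k d n f) i) := fun i => by
    rw [almostCI_eq_span]
    exact finiteDimensional_gradedPiece _ _
  have hrank : ∀ i : ℕ, (Module.finrank k (gradedPiece (almostCI k d n f) i) : ℤ) =
      intCoeff i P := fun i => by
    rw [almostCI_eq_span, finrank_gradedPiece, ncard_standardExponents_almostCI, ← hP, map_sub,
      intCoeff_natCast, intCoeff_natCast]
    simp only [sum_Ico_X_pow]
    rfl
  have := hfin i
  have := hfin (i + 1)
  refine h.failsWLPInDegree ?_
  have h1 := hrank i
  have h2 := hrank (i + 1)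
  rw [Nat.cast_succ, add_sub_cancel_right] at hle
  rw [Nat.cast_succ] at h2
  omega

end Lefschetz

open Lefschetz in
theorem proposition5p5 {k : Type*} [Field k] [CharZero k] (n m : ℕ) (hn : n = 2 * m) :
    (∀ (d : ℕ) (_ : 5 ≤ d) (_ : 4 ≤ n),
      Lefschetz.FailsWLPInDegree
        (Ideal.span (Set.range (fun i : Fin n => (MvPolynomial.X i : MvPolynomial (Fin n) k) ^ d) ∪
          {MvPolynomial.X ⟨0, by omega⟩ ^ 3 * MvPolynomial.X ⟨1, by omega⟩ ^ (d - 3)}))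
        (m * (d - 1) - 1)) ∧
    (∀ (_ : 4 ≤ n),
      Lefschetz.FailsWLPInDegree
        (Ideal.span (Set.range (fun i : Fin n => (MvPolynomial.X i : MvPolynomial (Fin n) k) ^ 4) ∪
          {MvPolynomial.X ⟨0, by omega⟩ * MvPolynomial.X ⟨1, by omega⟩ *
            MvPolynomial.X ⟨2, by omega⟩ * MvPolynomial.X ⟨3, by omega⟩}))
        (m * (4 - 1) - 1)) ∧
    (∀ (_ : 6 ≤ n),
      Lefschetz.FailsWLPInDegree
        (Ideal.span (Set.range (fun i : Fin n => (MvPolynomial.X i : MvPolynomial (Fin n) k) ^ 3) ∪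
          {MvPolynomial.X ⟨0, by omega⟩ * MvPolynomial.X ⟨1, by omega⟩ *
            MvPolynomial.X ⟨2, by omega⟩}))
        (m * (3 - 1) - 1)) := by
  refine ⟨fun d hd h4 => ?_, fun h4 => ?_, fun h6 => ?_⟩
  · obtain ⟨N, rfl⟩ := Nat.exists_eq_add_of_le' h4
    obtain ⟨p, rfl⟩ : ∃ p, m = p + 2 := ⟨m - 2, by omega⟩
    obtain rfl : N = 2 * p := by omega
    let f : ℕ → ℕ := fun j => if j = 0 then 3 else if j = 1 then d - 3 else 0
    have hw := (hasWitness_two k (f := f) (d := d) (a := 3) (b := d - 3) (by omega) rfl rfl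
      (by omega)).add_pairs
      (by omega) (p + 1)
    -- The 2p+2 variables outside the extra generator give `geomPoly d * T` with T = `geomPoly d ^
    -- (2 * p + 1)`.
    have hfail := failsWLPInDegree_almostCI (M := (p + 2) * (d - 1)) (n := 2 * p + 4) (f := f)
      (Nat.mul_pos (by omega) (by omega)) (by convert hw using 1 <;> ring)
      (P := geomPoly d * (geomPoly d * (geomPoly d * geomPoly d ^ (2 * p + 1))) -
        Polynomial.X ^ d * (geomPoly (d - 3) * (geomPoly 3 *
          (geomPoly d * geomPoly d ^ (2 * p + 1))))) ?_ ?_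
    · convert hfail using 1
      rw [almostCI]
      congr 3
      simp [Fin.prod_univ_succ, f]
    · have hX : (Polynomial.X : Polynomial ℤ) ^ d = Polynomial.X ^ 3 * Polynomial.X ^ (d - 3) := by
        rw [← pow_add]
        congr 1
        omega
      simp [Fin.prod_univ_succ, f, hX, show d - (d - 3) = 3 by omega]
      ring
    · refine intCoeff_sub_le_of_five_le hd (symmUnimodal_geomPoly_pow (by omega) (2 * p + 1)) ?_
      push_cast [show 1 ≤ d by omega]
      ring
  · obtain ⟨N, rfl⟩ := Nat.exists_eq_add_of_le' h4
    obtain ⟨p, rfl⟩ : ∃ p, m = p + 2 := ⟨m - 2, by omega⟩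
    obtain rfl : N = 2 * p := by omega
    let f : ℕ → ℕ := fun j => if j < 4 then 1 else 0
    have hlt : ∀ j : ℕ, ¬ j + 1 + 1 + 1 + 1 < 4 := by omega
    have hw := (hasWitness_four k (f := f) (fun i hi => if_pos hi)).add_pairs (by omega) p
    have hfail := failsWLPInDegree_almostCI (M := (p + 2) * (4 - 1)) (n := 2 * p + 4) (f := f)
      (by omega) (by convert hw using 1 <;> omega)
      (P := geomPoly 4 ^ 4 * geomPoly 4 ^ (2 * p) -
        Polynomial.X ^ 4 * (geomPoly 3 ^ 4 * geomPoly 4 ^ (2 * p))) ?_ ?_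
    · convert hfail using 1
      rw [almostCI]
      congr 3
      simp [Fin.prod_univ_succ, f, hlt, mul_assoc]
      rfl
    · simp [Fin.prod_univ_succ, f, hlt]
      ring
    · refine intCoeff_sub_le_four (symmUnimodal_geomPoly_pow (by omega) (2 * p)) ?_
      push_cast
      ring
  · obtain ⟨N, rfl⟩ := Nat.exists_eq_add_of_le' h6
    obtain ⟨p, rfl⟩ : ∃ p, m = p + 3 := ⟨m - 3, by omega⟩
    obtain rfl : N = 2 * p := by omega
    let f : ℕ → ℕ := fun j => if j < 3 then 1 else 0
    have hlt : ∀ j : ℕ, ¬ j + 1 + 1 + 1 + 1 + 1 + 1 < 3 := by omega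
    have hw := (hasWitness_six k (f := f) (fun i hi => if_pos hi)
      (fun i hi => if_neg (by omega))).add_pairs (by omega) p
    have hfail := failsWLPInDegree_almostCI (M := (p + 3) * (3 - 1)) (n := 2 * p + 6) (f := f)
      (by omega) (by convert hw using 1 <;> omega)
      (P := geomPoly 3 ^ 3 * geomPoly 3 ^ (2 * p + 3) -
        Polynomial.X ^ 3 * (geomPoly 2 ^ 3 * geomPoly 3 ^ (2 * p + 3))) ?_ ?_
    · convert hfail using 1
      rw [almostCI]
      congr 3
      simp [Fin.prod_univ_succ, f, hlt, mul_assoc]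
      rfl
    · simp [Fin.prod_univ_succ, f, hlt]
      ring
    · refine intCoeff_sub_le_three (symmUnimodal_geomPoly_pow (by omega) (2 * p + 3)) ?_
      push_cast
      ring
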